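/- Let $A>0$, $\sigma>0$, and let $h$ be a real random variable with an arbitrary distribution $P_h$. The fast fading channel $\mathcal G_{fast}$ maps an input $\mathbf x\in\mathbb R^n$ to $y_t=h_tx_t+z_t$, $t=1,\dots,n$, where $h_1,\dots,h_n$ are i.i.d. with distribution $P_h$ and, independently of them, $z_1,\dots,z_n$ are i.i.d. $N(0,\sigma^2)$; let $P_{\mathbf h}$ be the law of $\mathbf h=(h_1,\dots,h_n)$ and $f_{\mathbf z}(\mathbf z)=(2\pi\sigma^2)^{-n/2}e^{-\|\mathbf z\|_2^2/(2\sigma^2)}$. An $(M,n,\lambda_1,\lambda_2)$ deterministic identification (DI) code for this channel with channel side information (CSI) under the input constraint $A$ consists of codewords $\mathbf u_1,\dots,\mathbf u_M\in\mathbb R^n$ with $\|\mathbf u_i\|_2^2\le nA$ and decoding regions $D_{i,\mathbf h}\subset\mathbb R^n$ ($1\le i\le M$, $\mathbf h\in\mathbb R^n$), measurable in the sense that each $\{(\mathbf h,\mathbf y):\mathbf y\in D_{i,\mathbf h}\}$ is a Borel set, such that for all $i\ne j$ $$\int\int_{D_{i,\mathbf h}^c} f_{\mathbf z}(\mathbf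 y-\mathrm{diag}(\mathbf h)\mathbf u_i)\,d\mathbf y\,dP_{\mathbf h}\le\lambda_1,\qquad \int\int_{D_{j,\mathbf h}} f_{\mathbf z}(\mathbf y-\mathrm{diag}(\mathbf h)\mathbf u_i)\,d\mathbf y\,dP_{\mathbf h}\le\lambda_2$$ (the first inequality being required for every $i$). A rate $R>0$ is achievable if for all $\lambda_1,\lambda_2>0$ and all sufficiently large $n$ there is a $(\lfloor n^{nR}\rfloor,n,\lambda_1,\lambda_2)$ DI code. The capacity $C_{DI}^{CSI}(\mathcal G_{fast})\in[0,\infty]$ is the supremum of the achievable rates ($0$ if there are none). Theorem. 1. If $\mathbb E h^2<\infty$, then $C_{DI}^{CSI}(\mathcal G_{fast})\le 1/2$. 2. If $\mathbb P(h=0)=0$, then $C_{DI}^{CSI}(\mathcal G_{fast})\ge 1/4$. 3. If $\mathbb P(h=0)<1$ and $\mathbb E h^4<\infty$, then $C_{DI}^{CSI}(\mathcal G_{fast})\ge 1/4$. -/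

import Mathlib

open MeasureTheory Filter
open scoped ENNReal

namespace FastFading

noncomputable section

/-- Squared Euclidean norm `‖x‖₂²` of a vector of `ℝⁿ`. -/
def sqNorm {n : ℕ} (x : Fin n → ℝ) : ℝ := ∑ t, x t ^ 2

/-- Density of `n` i.i.d. `N(0, σ²)` noise variables:
`f_Z(z) = (2πσ²)^(-n/2) exp(-‖z‖₂² / (2σ²))`. -/
def noiseDensity (σ : ℝ) {n : ℕ} (z : Fin n → ℝ) : ℝ :=
  1 / (2 * Real.pi * σ ^ 2) ^ ((n : ℝ) / 2) * Real.exp (-sqNorm z / (2 * σ ^ 2))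

/-- The joint law of the `n` i.i.d. fading coefficients `𝐡 = (h₁, …, hₙ)`, each with law `P_h`. -/
def fadingLaw (Ph : Measure ℝ) (n : ℕ) : Measure (Fin n → ℝ) :=
  Measure.pi fun _ => Ph

/-- A DI code with `M` codewords and length `n` for the fast fading channel with channel side
information, under the input constraint `A`: the decoding regions may depend on the realization
`𝐡` of the fading vector, and do so measurably. -/
structure DICode (A : ℝ) (M n : ℕ) where
  /-- the codewords `𝐮ᵢ` -/
  u : Fin M → Fin n → ℝ
  /-- the decoding regions `D_{i,𝐡}` -/
  D : Fin M → (Fin n → ℝ) → Set (Fin n → ℝ)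
  power : ∀ i, sqNorm (u i) ≤ n * A
  measurable_D : ∀ i, MeasurableSet {p : (Fin n → ℝ) × (Fin n → ℝ) | p.2 ∈ D i p.1}

/-- Type I error `P_{e,1}(i) = ∫ ∫_{D_{i,𝐡}ᶜ} f_Z(𝐲 - diag(𝐡) 𝐮ᵢ) d𝐲 dP_𝐡`. -/
def DICode.err₁ {A : ℝ} {M n : ℕ} (C : DICode A M n) (Ph : Measure ℝ) (σ : ℝ) (i : Fin M) :
    ℝ≥0∞ :=
  ∫⁻ h, ∫⁻ y in (C.D i h)ᶜ,
    ENNReal.ofReal (noiseDensity σ fun t => y t - h t * C.u i t) ∂volume ∂fadingLaw Ph n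

/-- Type II error `P_{e,2}(i,j) = ∫ ∫_{D_{j,𝐡}} f_Z(𝐲 - diag(𝐡) 𝐮ᵢ) d𝐲 dP_𝐡`. -/
def DICode.err₂ {A : ℝ} {M n : ℕ} (C : DICode A M n) (Ph : Measure ℝ) (σ : ℝ) (i j : Fin M) :
    ℝ≥0∞ :=
  ∫⁻ h, ∫⁻ y in C.D j h,
    ENNReal.ofReal (noiseDensity σ fun t => y t - h t * C.u i t) ∂volume ∂fadingLaw Ph n

/-- `C` is an `(M, n, l₁, l₂)` DI code. -/
def DICode.IsReliable {A : ℝ} {M n : ℕ} (C : DICode A M n) (Ph : Measure ℝ) (σ l₁ l₂ : ℝ) :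
    Prop :=
  (∀ i, C.err₁ Ph σ i ≤ ENNReal.ofReal l₁) ∧
    ∀ i j, i ≠ j → C.err₂ Ph σ i j ≤ ENNReal.ofReal l₂

/-- The rate `R > 0` is achievable: for all `l₁, l₂ > 0` and all sufficiently large `n` there is an
`(n^{nR}, n, l₁, l₂)` DI code, the number `n^{nR}` being rounded down when it is not an integer. -/
def Achievable (Ph : Measure ℝ) (A σ R : ℝ) : Prop :=
  0 < R ∧ ∀ l₁ l₂ : ℝ, 0 < l₁ → 0 < l₂ → ∀ᶠ n : ℕ in atTop,
    ∃ C : DICode A ⌊(n : ℝ) ^ ((n : ℝ) * R)⌋₊ n, C.IsReliable Ph σ l₁ l₂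

/-- The DI capacity of the fast fading channel with channel side information: the supremum, in
`[0, ∞]`, of the achievable rates. -/
def capacity (Ph : Measure ℝ) (A σ : ℝ) : ℝ≥0∞ :=
  ⨆ (R : ℝ) (_ : Achievable Ph A σ R), ENNReal.ofReal R

end

end FastFading

/-!
Converse: shifting the noise vector by `w` raises the probability of an event by at most
`1 / 4 + O(‖w‖₂²)`. With `w = 𝐡 * (𝐮ᵢ - 𝐮ⱼ)` averaged over the fading, two messages can be told
apart only if `E[h²] ‖𝐮ᵢ - 𝐮ⱼ‖₂²` is bounded below. The codewords are then separated by a constant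
inside a ball of radius `√(n A)`, and comparing volumes gives `M ≤ (1 + K √n)ⁿ`.

Achievability: put a grid with `n ^ b` levels, `R < b < 1 / 4`, on each coordinate, and take the
codewords from a Gilbert–Varshamov code over this alphabet. They differ in a constant fraction of
the coordinates, so their squared distances are at least of order `n ^ (1 - 2 * b)`, much larger
than `√n`. The fading keeps a constant fraction of this, because `h²` exceeds some `c > 0` with
positive probability. The decoder accepts message `i` if `‖𝐲 - diag(𝐡) 𝐮ᵢ‖₂²` is close to its mean
`n σ²` under message `i`; the fluctuations of this quantity are only of order `√n`, and Chebyshev's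
inequality controls all errors.
-/

namespace FastFading

open ProbabilityTheory

noncomputable section

/-! ### Product measures -/

section Pi

variable {ι : Type*} [Fintype ι] {Ω : ι → Type*} [∀ i, MeasurableSpace (Ω i)]

lemma pi_withDensity_ofReal (μ : ∀ i, Measure (Ω i)) [∀ i, SigmaFinite (μ i)]
    {f : ∀ i, Ω i → ℝ} (hf : ∀ i, Integrable (f i) (μ i)) (hf₀ : ∀ i x, 0 ≤ f i x) :
    Measure.pi (fun i => (μ i).withDensity fun x => ENNReal.ofReal (f i x)) =
      (Measure.pi μ).withDensity fun x => ENNReal.ofReal (∏ i, f i (x i)) := by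
  have (i : ι) := isFiniteMeasure_withDensity_ofReal (hf i).2
  refine Measure.pi_eq fun s hs => ?_
  have hf_on (i : ι) : Integrable (f i) ((μ i).restrict (s i)) := (hf i).restrict
  rw [withDensity_apply _ (.univ_pi hs), Measure.restrict_pi_pi,
    ← ofReal_integral_eq_lintegral_ofReal (.fintype_prod_dep hf_on)
      (ae_of_all _ fun x => Finset.prod_nonneg fun i _ => hf₀ i (x i)),
    integral_fintype_prod_eq_prod,
    ENNReal.ofReal_prod_of_nonneg fun i _ => integral_nonneg (hf₀ i)]
  refine Finset.prod_congr rfl fun i _ => ?_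
  rw [withDensity_apply _ (hs i),
    ofReal_integral_eq_lintegral_ofReal (hf_on i) (ae_of_all _ (hf₀ i))]

variable {μ : ∀ i, Measure (Ω i)} [∀ i, IsProbabilityMeasure (μ i)] {X : ∀ i, Ω i → ℝ}

lemma memLp_sum_pi {p : ℝ≥0∞} (hX : ∀ i, MemLp (X i) p (μ i)) :
    MemLp (fun ω => ∑ i, X i (ω i)) p (Measure.pi μ) :=
  memLp_finsetSum _ fun i _ => (hX i).comp_measurePreserving (measurePreserving_eval μ i)

lemma integral_sum_pi (hX : ∀ i, Integrable (X i) (μ i)) :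
    ∫ ω, ∑ i, X i (ω i) ∂Measure.pi μ = ∑ i, ∫ x, X i x ∂μ i := by
  rw [integral_finsetSum _ fun i _ => integrable_comp_eval (hX i)]
  exact Finset.sum_congr rfl fun i _ => integral_comp_eval (hX i).1

lemma variance_fun_sum_pi (hX : ∀ i, MemLp (X i) 2 (μ i)) :
    Var[fun ω => ∑ i, X i (ω i); Measure.pi μ] = ∑ i, Var[X i; μ i] := by
  rw [← variance_sum_pi hX, Finset.sum_fn]

lemma pi_abs_sum_sub_ge_le (hX : ∀ i, MemLp (X i) 2 (μ i)) {c : ℝ} (hc : 0 < c) :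
    Measure.pi μ {ω | c ≤ |∑ i, X i (ω i) - ∑ i, ∫ x, X i x ∂μ i|} ≤
      ENNReal.ofReal ((∑ i, Var[X i; μ i]) / c ^ 2) := by
  rw [← variance_fun_sum_pi hX, ← integral_sum_pi fun i => (hX i).integrable one_le_two]
  exact meas_ge_le_variance_div_sq (memLp_sum_pi hX) hc

end Pi

/-! ### The squared norm -/

section SqNorm

variable {n : ℕ}

lemma sqNorm_nonneg (x : Fin n → ℝ) : 0 ≤ sqNorm x :=
  Finset.sum_nonneg fun _ _ => sq_nonneg _

@[fun_prop]
lemma measurable_sqNorm : Measurable (sqNorm : (Fin n → ℝ) → ℝ) := by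
  unfold sqNorm
  fun_prop

lemma sqNorm_add (z w : Fin n → ℝ) :
    sqNorm (z + w) = sqNorm z + 2 * ∑ t, w t * z t + sqNorm w := by
  simp only [sqNorm, Pi.add_apply, Finset.mul_sum, ← Finset.sum_add_distrib]
  exact Finset.sum_congr rfl fun t _ => by ring

lemma sqNorm_eq_norm_sq (x : Fin n → ℝ) : sqNorm x = ‖WithLp.toLp 2 x‖ ^ 2 := by
  simp only [sqNorm, EuclideanSpace.real_norm_sq_eq]

end SqNorm

/-! ### Gaussian noise -/

/-- The law `N(0, σ²)` of a single noise variable `zₜ`. -/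
def noiseCoordLaw (σ : ℝ) : Measure ℝ := gaussianReal 0 (σ ^ 2).toNNReal

/-- The law of the noise vector `𝐳 = (z₁, …, zₙ)`, the probability measure with density
`noiseDensity σ`; it turns the error integrals of a code into probabilities of noise events. -/
def noiseLaw (σ : ℝ) (n : ℕ) : Measure (Fin n → ℝ) := Measure.pi fun _ => noiseCoordLaw σ

instance (σ : ℝ) : IsProbabilityMeasure (noiseCoordLaw σ) := by
  unfold noiseCoordLaw
  infer_instance

instance (σ : ℝ) (n : ℕ) : IsProbabilityMeasure (noiseLaw σ n) := by
  unfold noiseLaw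
  infer_instance

section Moments

variable (σ : ℝ)

lemma memLp_id_noiseCoordLaw {p : ℝ≥0∞} (hp : p ≠ ∞) : MemLp (fun x => x) p (noiseCoordLaw σ) :=
  memLp_id_gaussianReal' p hp

lemma integral_id_noiseCoordLaw : ∫ x, x ∂noiseCoordLaw σ = 0 := integral_id_gaussianReal

lemma variance_id_noiseCoordLaw : Var[fun x => x; noiseCoordLaw σ] = σ ^ 2 := by
  rw [noiseCoordLaw, variance_fun_id_gaussianReal, Real.coe_toNNReal _ (sq_nonneg σ)]

lemma integral_sq_noiseCoordLaw : ∫ x, x ^ 2 ∂noiseCoordLaw σ = σ ^ 2 := by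
  rw [← variance_id_noiseCoordLaw,
    variance_of_integral_eq_zero aemeasurable_id' (integral_id_noiseCoordLaw σ)]

lemma memLp_sq_noiseCoordLaw : MemLp (fun x => x ^ 2) 2 (noiseCoordLaw σ) := by
  rw [memLp_two_iff_integrable_sq (by fun_prop)]
  have h := (memLp_id_noiseCoordLaw σ (p := (4 : ℕ)) (by simp)).integrable_norm_pow four_ne_zero
  refine h.congr (ae_of_all _ fun x => ?_)
  simp only [Real.norm_eq_abs, ← pow_mul, Even.pow_abs (show Even 4 by decide)]

variable {n : ℕ} (w : Fin n → ℝ)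

lemma memLp_inner_noiseLaw : MemLp (fun z => ∑ t, w t * z t) 2 (noiseLaw σ n) :=
  memLp_sum_pi fun t => (memLp_id_noiseCoordLaw σ ENNReal.ofNat_ne_top).const_mul (w t)

lemma integral_inner_noiseLaw : ∫ z, ∑ t, w t * z t ∂noiseLaw σ n = 0 := by
  rw [noiseLaw, integral_sum_pi (X := fun t x => w t * x) fun t =>
    ((memLp_id_noiseCoordLaw σ ENNReal.one_ne_top).integrable le_rfl).const_mul (w t)]
  refine Finset.sum_eq_zero fun t _ => (integral_const_mul (w t) _).trans ?_
  rw [integral_id_noiseCoordLaw, mul_zero]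

lemma variance_inner_noiseLaw : Var[fun z => ∑ t, w t * z t; noiseLaw σ n] = σ ^ 2 * sqNorm w := by
  rw [noiseLaw, variance_fun_sum_pi (X := fun t x => w t * x) fun t =>
    (memLp_id_noiseCoordLaw σ ENNReal.ofNat_ne_top).const_mul (w t)]
  simp only [variance_const_mul _ fun x => x, variance_id_noiseCoordLaw, sqNorm, mul_comm (σ ^ 2),
    Finset.sum_mul]

lemma integral_inner_sq_noiseLaw :
    ∫ z, (∑ t, w t * z t) ^ 2 ∂noiseLaw σ n = σ ^ 2 * sqNorm w := by
  rw [← variance_inner_noiseLaw, variance_of_integral_eq_zero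
    (memLp_inner_noiseLaw σ w).1.aemeasurable (integral_inner_noiseLaw σ w)]

lemma noiseLaw_abs_inner_ge_le {c : ℝ} (hc : 0 < c) :
    noiseLaw σ n {z | c ≤ |∑ t, w t * z t|} ≤ ENNReal.ofReal (σ ^ 2 * sqNorm w / c ^ 2) := by
  have h := meas_ge_le_variance_div_sq (memLp_inner_noiseLaw σ w) hc
  simpa only [integral_inner_noiseLaw, sub_zero, variance_inner_noiseLaw] using h

lemma noiseLaw_abs_sqNorm_sub_ge_le (n : ℕ) {c : ℝ} (hc : 0 < c) :
    noiseLaw σ n {z | c ≤ |sqNorm z - n * σ ^ 2|} ≤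
      ENNReal.ofReal (n * Var[fun x => x ^ 2; noiseCoordLaw σ] / c ^ 2) := by
  have h := pi_abs_sum_sub_ge_le (fun _ : Fin n => memLp_sq_noiseCoordLaw σ) hc
  simpa only [integral_sq_noiseCoordLaw, Finset.sum_const, Finset.card_univ, Fintype.card_fin,
    nsmul_eq_mul, noiseLaw, sqNorm] using h

end Moments

section Density

variable {σ : ℝ} {n : ℕ}

@[fun_prop]
lemma measurable_noiseDensity : Measurable (noiseDensity σ : (Fin n → ℝ) → ℝ) := by
  unfold noiseDensity
  fun_prop

lemma noiseDensity_nonneg (z : Fin n → ℝ) : 0 ≤ noiseDensity σ z := by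
  unfold noiseDensity
  positivity

lemma noiseDensity_eq_prod (z : Fin n → ℝ) :
    noiseDensity σ z = ∏ t, gaussianPDFReal 0 (σ ^ 2).toNNReal (z t) := by
  have h2πσ : 0 ≤ 2 * Real.pi * σ ^ 2 := by positivity
  simp only [gaussianPDFReal, Real.coe_toNNReal _ (sq_nonneg σ), sub_zero]
  rw [Finset.prod_mul_distrib, ← Real.exp_sum, Finset.prod_const, Finset.card_univ,
    Fintype.card_fin, noiseDensity, sqNorm, inv_pow, one_div]
  congr 2
  · rw [Real.sqrt_eq_rpow, ← Real.rpow_mul_natCast h2πσ, one_div_mul_eq_div]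
  · rw [← Finset.sum_div, Finset.sum_neg_distrib]

lemma withDensity_noiseDensity (hσ : σ ≠ 0) :
    volume.withDensity (fun z : Fin n → ℝ => ENNReal.ofReal (noiseDensity σ z)) =
      noiseLaw σ n := by
  have hvar : (σ ^ 2).toNNReal ≠ 0 := by simpa using hσ
  simp only [noiseLaw, noiseCoordLaw, gaussianReal_of_var_ne_zero _ hvar, gaussianPDF_def,
    noiseDensity_eq_prod]
  exact (pi_withDensity_ofReal _ (fun _ => integrable_gaussianPDFReal _ _)
    fun _ => gaussianPDFReal_nonneg _ _).symm

lemma lintegral_noiseLaw (hσ : σ ≠ 0) {g : (Fin n → ℝ) → ℝ≥0∞} (hg : Measurable g) :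
    ∫⁻ z, g z ∂noiseLaw σ n = ∫⁻ z, ENNReal.ofReal (noiseDensity σ z) * g z := by
  rw [← withDensity_noiseDensity hσ, lintegral_withDensity_eq_lintegral_mul _ (by fun_prop) hg]
  rfl

lemma setLIntegral_noiseDensity_sub (hσ : σ ≠ 0) (c : Fin n → ℝ) {S : Set (Fin n → ℝ)}
    (hS : MeasurableSet S) :
    ∫⁻ y in S, ENNReal.ofReal (noiseDensity σ (y - c)) = noiseLaw σ n {z | z + c ∈ S} := by
  have hS_shift : MeasurableSet {z : Fin n → ℝ | z + c ∈ S} := measurable_add_const c hS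
  rw [← withDensity_noiseDensity hσ, withDensity_apply _ hS_shift,
    ← (measurePreserving_add_right volume c).setLIntegral_comp_preimage hS (by fun_prop)]
  simp only [add_sub_cancel_right]
  rfl

end Density

/-! ### Shifting the noise -/

section Shift

variable {σ : ℝ} {n : ℕ}

lemma noiseDensity_le_add (hσ : σ ≠ 0) (z w : Fin n → ℝ) :
    noiseDensity σ z ≤ noiseDensity σ (z + w) + noiseDensity σ z *
      (1 / 4 + sqNorm w / (2 * σ ^ 2) + (∑ t, w t * z t) ^ 2 / σ ^ 4) := by
  set r := ∑ t, w t * z t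
  set e := r / σ ^ 2 + sqNorm w / (2 * σ ^ 2)
  have h_shift : noiseDensity σ (z + w) = noiseDensity σ z * Real.exp (-e) := by
    unfold noiseDensity e
    rw [mul_assoc _ (Real.exp _), ← Real.exp_add, sqNorm_add]
    congr 2
    field_simp
    ring
  have h_exp : 1 - e ≤ Real.exp (-e) := Real.one_sub_le_exp_neg e
  have h_sq : r / σ ^ 2 ≤ 1 / 4 + r ^ 2 / σ ^ 4 := by
    have : r ^ 2 / σ ^ 4 = (r / σ ^ 2) ^ 2 := by rw [div_pow, ← pow_mul]
    linarith [sq_nonneg (r / σ ^ 2 - 1 / 2)]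
  rw [h_shift, ← mul_add]
  exact le_mul_of_one_le_right (noiseDensity_nonneg z) (by linarith)

lemma lintegral_noiseLaw_shift_bound (hσ : σ ≠ 0) (w : Fin n → ℝ) :
    ∫⁻ z, ENNReal.ofReal (1 / 4 + sqNorm w / (2 * σ ^ 2) + (∑ t, w t * z t) ^ 2 / σ ^ 4)
        ∂noiseLaw σ n =
      ENNReal.ofReal (1 / 4 + 3 / (2 * σ ^ 2) * sqNorm w) := by
  have h_sq : Integrable (fun z => (∑ t, w t * z t) ^ 2 / σ ^ 4) (noiseLaw σ n) :=
    (memLp_inner_noiseLaw σ w).integrable_sq.div_const _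
  have h_nonneg := sqNorm_nonneg w
  have h_int : Integrable (fun z => 1 / 4 + sqNorm w / (2 * σ ^ 2) +
      (∑ t, w t * z t) ^ 2 / σ ^ 4) (noiseLaw σ n) := (integrable_const _).add h_sq
  rw [← ofReal_integral_eq_lintegral_ofReal h_int (ae_of_all _ fun z => by positivity),
    integral_add (integrable_const _) h_sq, integral_div, integral_inner_sq_noiseLaw,
    integral_const, probReal_univ, one_smul]
  congr 1
  field_simp
  ring

lemma noiseLaw_shift_le (hσ : σ ≠ 0) (w : Fin n → ℝ) {T : Set (Fin n → ℝ)}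
    (hT : MeasurableSet T) :
    noiseLaw σ n {z | z + w ∈ T} ≤
      noiseLaw σ n T + ENNReal.ofReal (1 / 4 + 3 / (2 * σ ^ 2) * sqNorm w) := by
  set S := {z : Fin n → ℝ | z + w ∈ T}
  have hS : MeasurableSet S := measurable_add_const w hT
  have h_nonneg := sqNorm_nonneg w
  let g (z : Fin n → ℝ) : ℝ := 1 / 4 + sqNorm w / (2 * σ ^ 2) + (∑ t, w t * z t) ^ 2 / σ ^ 4
  have h_pointwise (z : Fin n → ℝ) : ENNReal.ofReal (noiseDensity σ z) ≤
      ENNReal.ofReal (noiseDensity σ (z - -w)) +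
        ENNReal.ofReal (noiseDensity σ z) * ENNReal.ofReal (g z) := by
    rw [sub_neg_eq_add, ← ENNReal.ofReal_mul (noiseDensity_nonneg z),
      ← ENNReal.ofReal_add (noiseDensity_nonneg _)
        (mul_nonneg (noiseDensity_nonneg z) (by positivity))]
    exact ENNReal.ofReal_le_ofReal (noiseDensity_le_add hσ z w)
  calc noiseLaw σ n S
      = ∫⁻ z in S, ENNReal.ofReal (noiseDensity σ z) := by
        rw [← withDensity_noiseDensity hσ, withDensity_apply _ hS]
    _ ≤ ∫⁻ z in S, (ENNReal.ofReal (noiseDensity σ (z - -w)) +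
          ENNReal.ofReal (noiseDensity σ z) * ENNReal.ofReal (g z)) :=
        lintegral_mono h_pointwise
    _ ≤ (∫⁻ z in S, ENNReal.ofReal (noiseDensity σ (z - -w))) +
          ∫⁻ z, ENNReal.ofReal (noiseDensity σ z) * ENNReal.ofReal (g z) := by
        rw [lintegral_add_left (by fun_prop)]
        exact add_le_add_right (setLIntegral_le_lintegral S _) _
    _ = noiseLaw σ n T + ENNReal.ofReal (1 / 4 + 3 / (2 * σ ^ 2) * sqNorm w) := by
        rw [setLIntegral_noiseDensity_sub hσ _ hS, ← lintegral_noiseLaw hσ (by fun_prop),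
          lintegral_noiseLaw_shift_bound hσ]
        simp only [S, Set.mem_ofPred_eq, neg_add_cancel_right, Set.ofPred_mem_eq]

end Shift

/-! ### Error probabilities -/

section Errors

variable {Ph : Measure ℝ} {A σ : ℝ} {M n : ℕ}

instance [IsProbabilityMeasure Ph] : IsProbabilityMeasure (fadingLaw Ph n) := by
  unfold fadingLaw
  infer_instance

/-- The probability, over the noise alone, that message `j` is accepted when message `i` is sent
and the fading vector is `𝐡`. -/
def DICode.acceptProb (C : DICode A M n) (σ : ℝ) (i j : Fin M) (h : Fin n → ℝ) : ℝ≥0∞ :=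
  noiseLaw σ n {z | z + h * C.u i ∈ C.D j h}

lemma DICode.measurableSet_D (C : DICode A M n) (i : Fin M) (h : Fin n → ℝ) :
    MeasurableSet (C.D i h) :=
  measurable_prodMk_left (C.measurable_D i)

@[fun_prop]
lemma DICode.measurable_acceptProb (C : DICode A M n) (i j : Fin M) :
    Measurable (C.acceptProb σ i j) := by
  have h_output : Measurable fun p : (Fin n → ℝ) × (Fin n → ℝ) => (p.1, p.2 + p.1 * C.u i) := by
    fun_prop
  exact measurable_measure_prodMk_left (h_output (C.measurable_D j))

lemma DICode.err₁_eq_lintegral (hσ : σ ≠ 0) (C : DICode A M n) (i : Fin M) :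
    C.err₁ Ph σ i = ∫⁻ h, noiseLaw σ n {z | z + h * C.u i ∈ C.D i h}ᶜ ∂fadingLaw Ph n :=
  lintegral_congr fun h => setLIntegral_noiseDensity_sub hσ (h * C.u i)
    (C.measurableSet_D i h).compl

lemma DICode.err₂_eq_lintegral_acceptProb (hσ : σ ≠ 0) (C : DICode A M n) (i j : Fin M) :
    C.err₂ Ph σ i j = ∫⁻ h, C.acceptProb σ i j h ∂fadingLaw Ph n :=
  lintegral_congr fun h => setLIntegral_noiseDensity_sub hσ (h * C.u i) (C.measurableSet_D j h)

lemma DICode.err₁_add_lintegral_acceptProb [IsProbabilityMeasure Ph] (hσ : σ ≠ 0)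
    (C : DICode A M n) (i : Fin M) :
    C.err₁ Ph σ i + ∫⁻ h, C.acceptProb σ i i h ∂fadingLaw Ph n = 1 := by
  have h_accept (h : Fin n → ℝ) : MeasurableSet {z : Fin n → ℝ | z + h * C.u i ∈ C.D i h} :=
    measurable_add_const _ (C.measurableSet_D i h)
  rw [C.err₁_eq_lintegral hσ, ← lintegral_add_right _ (C.measurable_acceptProb i i)]
  simp only [acceptProb, add_comm (noiseLaw σ n _ᶜ), measure_add_measure_compl (h_accept _),
    measure_univ, lintegral_one]

lemma DICode.acceptProb_le_acceptProb_add (hσ : σ ≠ 0) (C : DICode A M n) (i j k : Fin M)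
    (h : Fin n → ℝ) :
    C.acceptProb σ i k h ≤ C.acceptProb σ j k h +
      ENNReal.ofReal (1 / 4 + 3 / (2 * σ ^ 2) * sqNorm (h * (C.u i - C.u j))) := by
  have h_shift := noiseLaw_shift_le hσ (h * (C.u i - C.u j))
    (measurable_add_const (h * C.u j) (C.measurableSet_D k h))
  simp only [Set.mem_preimage, add_assoc, ← mul_add, sub_add_cancel] at h_shift
  exact h_shift

end Errors

/-! ### The converse -/

section Converse

variable {Ph : Measure ℝ} [IsProbabilityMeasure Ph] {A σ : ℝ} {M n : ℕ}

lemma integrable_sqNorm_mul (hPh : Integrable (fun x : ℝ => x ^ 2) Ph) (d : Fin n → ℝ) :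
    Integrable (fun h => sqNorm (h * d)) (fadingLaw Ph n) := by
  simp only [sqNorm, Pi.mul_apply, mul_pow]
  exact integrable_finsetSum _ fun t _ => (integrable_comp_eval (μ := fun _ => Ph) hPh).mul_const _

lemma integral_sqNorm_mul (hPh : Integrable (fun x : ℝ => x ^ 2) Ph) (d : Fin n → ℝ) :
    ∫ h, sqNorm (h * d) ∂fadingLaw Ph n = (∫ x, x ^ 2 ∂Ph) * sqNorm d := by
  simp only [sqNorm, Pi.mul_apply, mul_pow]
  rw [fadingLaw, integral_sum_pi (X := fun t x => x ^ 2 * d t ^ 2) fun t => hPh.mul_const _,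
    Finset.mul_sum]
  exact Finset.sum_congr rfl fun t _ => integral_mul_const _ _

lemma DICode.one_le_err₁_add_err₂_add (hPh : Integrable (fun x : ℝ => x ^ 2) Ph) (hσ : σ ≠ 0)
    (C : DICode A M n) (i j : Fin M) :
    1 ≤ C.err₁ Ph σ i + (C.err₂ Ph σ j i + ENNReal.ofReal
      (1 / 4 + 3 / (2 * σ ^ 2) * ((∫ x, x ^ 2 ∂Ph) * sqNorm (C.u i - C.u j)))) := by
  set d := C.u i - C.u j
  have h_int : Integrable (fun h => 3 / (2 * σ ^ 2) * sqNorm (h * d)) (fadingLaw Ph n) :=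
    (integrable_sqNorm_mul hPh d).const_mul _
  have h_nonneg (h : Fin n → ℝ) : 0 ≤ 1 / 4 + 3 / (2 * σ ^ 2) * sqNorm (h * d) := by
    have := sqNorm_nonneg (h * d)
    positivity
  calc 1 = C.err₁ Ph σ i + ∫⁻ h, C.acceptProb σ i i h ∂fadingLaw Ph n :=
        (C.err₁_add_lintegral_acceptProb hσ i).symm
    _ ≤ C.err₁ Ph σ i + ∫⁻ h, (C.acceptProb σ j i h +
          ENNReal.ofReal (1 / 4 + 3 / (2 * σ ^ 2) * sqNorm (h * d))) ∂fadingLaw Ph n := by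
        gcongr with h
        exact C.acceptProb_le_acceptProb_add hσ i j i h
    _ = _ := by
        have h_int' : Integrable (fun h => 1 / 4 + 3 / (2 * σ ^ 2) * sqNorm (h * d))
          (fadingLaw Ph n) := (integrable_const _).add h_int
        rw [lintegral_add_left (by fun_prop), ← C.err₂_eq_lintegral_acceptProb hσ,
          ← ofReal_integral_eq_lintegral_ofReal h_int' (ae_of_all _ h_nonneg),
          integral_add (integrable_const _) h_int, integral_const_mul, integral_sqNorm_mul hPh,
          integral_const, probReal_univ, one_smul]

lemma DICode.IsReliable.sub_le_mul_sqNorm_sub (hPh : Integrable (fun x : ℝ => x ^ 2) Ph)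
    (hσ : σ ≠ 0) {C : DICode A M n} {l₁ l₂ : ℝ} (hl₁ : 0 ≤ l₁) (hl₂ : 0 ≤ l₂)
    (hC : C.IsReliable Ph σ l₁ l₂) {i j : Fin M} (hij : i ≠ j) :
    3 / 4 - l₁ - l₂ ≤ 3 / (2 * σ ^ 2) * ((∫ x, x ^ 2 ∂Ph) * sqNorm (C.u i - C.u j)) := by
  have : 0 ≤ ∫ x, x ^ 2 ∂Ph := integral_nonneg fun x => sq_nonneg x
  have h_sqNorm := sqNorm_nonneg (C.u i - C.u j)
  have h_one := (C.one_le_err₁_add_err₂_add hPh hσ i j).trans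
    (add_le_add (hC.1 i) (add_le_add (hC.2 j i hij.symm) le_rfl))
  rw [← ENNReal.ofReal_add hl₂ (by positivity), ← ENNReal.ofReal_add hl₁ (by positivity),
    ENNReal.one_le_ofReal] at h_one
  linarith

lemma DICode.IsReliable.div_le_sqNorm_sub (hPh : Integrable (fun x : ℝ => x ^ 2) Ph)
    (hσ : σ ≠ 0) {C : DICode A M n} (hC : C.IsReliable Ph σ (1 / 4) (1 / 4)) {i j : Fin M}
    (hij : i ≠ j) :
    σ ^ 2 / (6 * ((∫ x, x ^ 2 ∂Ph) + 1)) ≤ sqNorm (C.u i - C.u j) := by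
  have h_sub := hC.sub_le_mul_sqNorm_sub hPh hσ (by norm_num) (by norm_num) hij
  set m := ∫ x, x ^ 2 ∂Ph
  set s := sqNorm (C.u i - C.u j)
  have hm : 0 ≤ m := integral_nonneg fun x => sq_nonneg x
  have hs : 0 ≤ s := sqNorm_nonneg _
  rw [div_mul_eq_mul_div, le_div_iff₀ (by positivity)] at h_sub
  rw [div_le_iff₀ (by positivity)]
  linarith

lemma card_le_of_pairwise_le_dist {E ι : Type*} [NormedAddCommGroup E] [NormedSpace ℝ E]
    [FiniteDimensional ℝ E] [Fintype ι] {x : ι → E} {r δ : ℝ} (hr : 0 ≤ r) (hδ : 0 < δ)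
    (hx : ∀ i, ‖x i‖ ≤ r) (hsep : Pairwise fun i j => δ ≤ dist (x i) (x j)) :
    (Fintype.card ι : ℝ) ≤ (1 + 2 * r / δ) ^ Module.finrank ℝ E := by
  borelize E
  let μ : Measure E := Measure.addHaar
  have h_disj : Pairwise (Function.onFun Disjoint fun i => Metric.ball (x i) (δ / 2)) :=
    fun i j hij => Metric.ball_disjoint_ball (by linarith [hsep hij])
  have h_sub : (⋃ i, Metric.ball (x i) (δ / 2)) ⊆ Metric.ball 0 (r + δ / 2) :=
    Set.iUnion_subset fun i => Metric.ball_subset_ball' (by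
      rw [dist_zero_right]
      linarith [hx i])
  have h_vol := measure_mono (μ := μ) h_sub
  simp only [measure_iUnion h_disj fun _ => Metric.isOpen_ball.measurableSet,
    Measure.addHaar_ball_of_pos μ _ (half_pos hδ),
    Measure.addHaar_ball_of_pos μ _ (show 0 < r + δ / 2 by positivity), tsum_fintype,
    Finset.sum_const, Finset.card_univ, nsmul_eq_mul, ← mul_assoc] at h_vol
  rw [ENNReal.mul_le_mul_iff_left (Metric.measure_ball_pos μ _ one_pos).ne'
      measure_ball_lt_top.ne, ← ENNReal.ofReal_natCast, ← ENNReal.ofReal_mul (by positivity),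
    ENNReal.ofReal_le_ofReal_iff (by positivity)] at h_vol
  have h_ratio : 1 + 2 * r / δ = (r + δ / 2) / (δ / 2) := by
    field_simp
    ring
  rwa [h_ratio, div_pow, le_div_iff₀ (by positivity)]

lemma DICode.card_le_of_pairwise_le_sqNorm_sub (C : DICode A M n) {δ : ℝ} (hδ : 0 < δ)
    (hsep : Pairwise fun i j => δ ^ 2 ≤ sqNorm (C.u i - C.u j)) :
    (M : ℝ) ≤ (1 + 2 * √(n * A) / δ) ^ n := by
  let x (i : Fin M) : EuclideanSpace ℝ (Fin n) := WithLp.toLp 2 (C.u i)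
  have h_norm (i : Fin M) : ‖x i‖ ≤ √(n * A) :=
    Real.le_sqrt_of_sq_le ((sqNorm_eq_norm_sq _).symm.trans_le (C.power i))
  have h_dist : Pairwise fun i j => δ ≤ dist (x i) (x j) := fun i j hij => by
    simp only [x, dist_eq_norm, ← WithLp.toLp_sub]
    exact (sq_le_sq₀ hδ.le (norm_nonneg _)).1 ((hsep hij).trans_eq (sqNorm_eq_norm_sq _))
  have h_card := card_le_of_pairwise_le_dist (Real.sqrt_nonneg (n * A)) hδ h_norm h_dist
  rwa [Fintype.card_fin, finrank_euclideanSpace_fin] at h_card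

lemma eventually_pow_lt_floor_rpow {K a R : ℝ} (hK : 0 ≤ K) (hR : 0 < R) (haR : a < R) :
    ∀ᶠ n : ℕ in atTop, (1 + K * (n : ℝ) ^ a) ^ n < ⌊(n : ℝ) ^ (n * R)⌋₊ := by
  have h_large {c : ℝ} (hc : 0 < c) : Tendsto (fun n : ℕ => (n : ℝ) ^ c) atTop atTop :=
    (tendsto_rpow_atTop hc).comp tendsto_natCast_atTop_atTop
  filter_upwards [(h_large hR).eventually_gt_atTop 4,
    (h_large (sub_pos.2 haR)).eventually_gt_atTop (2 * K), eventually_ge_atTop 1]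
    with n h_four h_K hn
  have hn₀ : (0 : ℝ) < n := by exact_mod_cast hn
  have h_base : 1 + K * (n : ℝ) ^ a + 1 < (n : ℝ) ^ R := by
    have := mul_lt_mul_of_pos_right h_K (Real.rpow_pos_of_pos hn₀ a)
    rw [← Real.rpow_add hn₀, sub_add_cancel] at this
    linarith
  have h_pow : (1 + K * (n : ℝ) ^ a) ^ n + 1 < (n : ℝ) ^ (n * R) := calc
    (1 + K * (n : ℝ) ^ a) ^ n + 1 = (1 + K * (n : ℝ) ^ a) ^ n + 1 ^ n := by rw [one_pow]
    _ ≤ (1 + K * (n : ℝ) ^ a + 1) ^ n :=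
      pow_add_pow_le (by positivity) zero_le_one (Nat.one_le_iff_ne_zero.1 hn)
    _ < ((n : ℝ) ^ R) ^ n :=
      pow_lt_pow_left₀ h_base (by positivity) (Nat.one_le_iff_ne_zero.1 hn)
    _ = (n : ℝ) ^ (n * R) := by rw [← Real.rpow_mul_natCast hn₀.le, mul_comm R]
  linarith [Nat.lt_floor_add_one ((n : ℝ) ^ (n * R))]

theorem Achievable.le_half (hPh : Integrable (fun x : ℝ => x ^ 2) Ph) (hσ : σ ≠ 0) {R : ℝ}
    (hR : Achievable Ph A σ R) : R ≤ 1 / 2 := by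
  by_contra! h_half
  set m := ∫ x, x ^ 2 ∂Ph
  have : 0 ≤ m := integral_nonneg fun x => sq_nonneg x
  set δ := √(σ ^ 2 / (6 * (m + 1)))
  have hδ : 0 < δ := by positivity
  obtain ⟨n, ⟨C, hC⟩, h_count⟩ := ((hR.2 (1 / 4) (1 / 4) (by norm_num) (by norm_num)).and
    (eventually_pow_lt_floor_rpow (show 0 ≤ 2 * √A / δ by positivity) hR.1 h_half)).exists
  have h_sep : Pairwise fun i j => δ ^ 2 ≤ sqNorm (C.u i - C.u j) := fun i j hij => by
    rw [Real.sq_sqrt (by positivity)]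
    exact hC.div_le_sqNorm_sub hPh hσ hij
  have h_radius : 2 * √(n * A) / δ = 2 * √A / δ * (n : ℝ) ^ (1 / 2 : ℝ) := by
    rw [Real.sqrt_mul n.cast_nonneg, ← Real.sqrt_eq_rpow]
    ring
  have h_card := C.card_le_of_pairwise_le_sqNorm_sub hδ h_sep
  rw [h_radius] at h_card
  exact h_count.not_ge h_card

theorem capacity_le_half (hPh : Integrable (fun x : ℝ => x ^ 2) Ph) (hσ : σ ≠ 0) :
    capacity Ph A σ ≤ 1 / 2 :=
  iSup₂_le fun R hR => (ENNReal.ofReal_le_ofReal (hR.le_half hPh hσ)).trans_eq (by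
    rw [ENNReal.ofReal_div_of_pos two_pos, ENNReal.ofReal_one, ENNReal.ofReal_ofNat])

end Converse

/-! ### A Gilbert–Varshamov bound -/

lemma card_hammingBall_le {ι α : Type*} [Fintype ι] [DecidableEq ι] [Fintype α] [DecidableEq α]
    [Nonempty α] (c : ι → α) (k : ℕ) :
    (Finset.univ.filter fun x => hammingDist x c ≤ k).card ≤
      2 ^ Fintype.card ι * Fintype.card α ^ k := by
  let changesOn (S : Finset ι) : Finset (ι → α) :=
    Fintype.piFinset fun i => if i ∈ S then Finset.univ else {c i}
  have h_sub : (Finset.univ.filter fun x => hammingDist x c ≤ k) ⊆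
      (Finset.univ.filter fun S : Finset ι => S.card ≤ k).biUnion changesOn := by
    intro x hx
    refine Finset.mem_biUnion.2 ⟨Finset.univ.filter fun i => x i ≠ c i, ?_, ?_⟩
    · exact Finset.mem_filter.2 ⟨Finset.mem_univ _, (Finset.mem_filter.1 hx).2⟩
    · refine Fintype.mem_piFinset.2 fun i => ?_
      by_cases h : x i = c i <;> simp [h]
  have h_changes (S : Finset ι) (hS : S ∈ Finset.univ.filter fun S : Finset ι => S.card ≤ k) :
      (changesOn S).card ≤ Fintype.card α ^ k := by
    simp only [changesOn, Fintype.card_piFinset, apply_ite Finset.card, Finset.card_univ,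
      Finset.card_singleton, Finset.prod_ite_mem, Finset.univ_inter, Finset.prod_const]
    exact Nat.pow_le_pow_right Fintype.card_pos (Finset.mem_filter.1 hS).2
  refine (Finset.card_le_card h_sub).trans
    ((Finset.card_biUnion_le_card_mul _ _ _ h_changes).trans (Nat.mul_le_mul_right _ ?_))
  exact (Finset.card_filter_le _ _).trans_eq (Fintype.card_finset)

lemma exists_pow_le_card_mul_of_pairwise_lt_hammingDist (ι α : Type*) [Fintype ι] [Fintype α]
    [DecidableEq α] [Nonempty α] (k : ℕ) :
    ∃ C : Finset (ι → α), (C : Set (ι → α)).Pairwise (fun x y => k < hammingDist x y) ∧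
      Fintype.card α ^ Fintype.card ι ≤ C.card * (2 ^ Fintype.card ι * Fintype.card α ^ k) := by
  classical
  let IsCode (C : Finset (ι → α)) : Prop :=
    (C : Set (ι → α)).Pairwise fun x y => k < hammingDist x y
  obtain ⟨C, -, hC⟩ := Finite.exists_le_maximal (p := IsCode) (a := ∅) (by simp [IsCode])
  have h_cover (x : ι → α) : ∃ c ∈ C, hammingDist x c ≤ k := by
    by_contra! hx
    have h_insert : IsCode (insert x C) := by
      simp only [IsCode, Finset.coe_insert]
      exact hC.prop.insert fun c hc _ => ⟨hx c hc, hammingDist_comm x c ▸ hx c hc⟩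
    have hxC : x ∈ C := hC.le_of_ge h_insert (Finset.subset_insert x C) (Finset.mem_insert_self x C)
    simpa using hx x hxC
  refine ⟨C, hC.prop, ?_⟩
  calc Fintype.card α ^ Fintype.card ι = (Finset.univ : Finset (ι → α)).card := by simp
    _ ≤ (C.biUnion fun c => Finset.univ.filter fun x => hammingDist x c ≤ k).card :=
        Finset.card_le_card fun x _ => by simpa using h_cover x
    _ ≤ C.card * (2 ^ Fintype.card ι * Fintype.card α ^ k) :=
        Finset.card_biUnion_le_card_mul _ _ _ fun c _ => card_hammingBall_le c k

lemma rpow_one_sub_div_two_pow_le {q M n : ℕ} {θ : ℝ} (hq : 1 ≤ q) (hθ : 0 ≤ θ)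
    (hM : q ^ n ≤ M * (2 ^ n * q ^ ⌊θ * n⌋₊)) : ((q : ℝ) ^ (1 - θ) / 2) ^ n ≤ M := by
  have hq₁ : (1 : ℝ) ≤ q := by exact_mod_cast hq
  have hq₀ : (0 : ℝ) < q := by linarith
  have h_floor : (q : ℝ) ^ ⌊θ * n⌋₊ ≤ (q : ℝ) ^ (θ * n) := by
    rw [← Real.rpow_natCast]
    exact Real.rpow_le_rpow_of_exponent_le hq₁ (Nat.floor_le (by positivity))
  rw [div_pow, div_le_iff₀ (by positivity)]
  refine le_of_mul_le_mul_right ?_ (Real.rpow_pos_of_pos hq₀ (θ * n))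
  calc ((q : ℝ) ^ (1 - θ)) ^ n * (q : ℝ) ^ (θ * n) = (q : ℝ) ^ n := by
        rw [← Real.rpow_mul_natCast hq₀.le, ← Real.rpow_add hq₀, ← Real.rpow_natCast]
        ring_nf
    _ ≤ M * (2 ^ n * (q : ℝ) ^ ⌊θ * n⌋₊) := by exact_mod_cast hM
    _ ≤ M * (2 ^ n * (q : ℝ) ^ (θ * n)) := by gcongr
    _ = M * 2 ^ n * (q : ℝ) ^ (θ * n) := by ring

lemma exists_pairwise_mul_le_hammingDist {b R : ℝ} (hb : 0 < b) (hRb : R < b) :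
    ∃ θ > (0 : ℝ), ∀ᶠ n : ℕ in atTop,
      ∃ x : Fin ⌊(n : ℝ) ^ (n * R)⌋₊ → Fin n → Fin ⌈(n : ℝ) ^ b⌉₊,
        Pairwise fun i j => θ * n ≤ hammingDist (x i) (x j) := by
  obtain ⟨θ, hθ, hθ_lt⟩ := exists_between
    (lt_min one_pos (sub_pos.2 ((div_lt_one hb).2 hRb)) : 0 < min 1 (1 - R / b))
  obtain ⟨hθ₁, hθR⟩ := lt_min_iff.1 hθ_lt
  have h_gap : 0 < b * (1 - θ) - R := by
    rw [lt_sub_comm, div_lt_iff₀ hb] at hθR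
    linarith
  refine ⟨θ, hθ, ?_⟩
  filter_upwards [((tendsto_rpow_atTop h_gap).comp
    tendsto_natCast_atTop_atTop).eventually_ge_atTop 2, eventually_ge_atTop 1] with n h_two hn
  have hn₀ : (0 : ℝ) < n := by exact_mod_cast hn
  have hq : 0 < ⌈(n : ℝ) ^ b⌉₊ := Nat.ceil_pos.2 (by positivity)
  have : NeZero ⌈(n : ℝ) ^ b⌉₊ := ⟨hq.ne'⟩
  obtain ⟨W, hW, h_card⟩ := exists_pow_le_card_mul_of_pairwise_lt_hammingDist
    (Fin n) (Fin ⌈(n : ℝ) ^ b⌉₊) ⌊θ * n⌋₊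
  simp only [Fintype.card_fin] at h_card
  have h_rate : (n : ℝ) ^ R ≤ (⌈(n : ℝ) ^ b⌉₊ : ℝ) ^ (1 - θ) / 2 := by
    rw [le_div_iff₀ two_pos]
    calc (n : ℝ) ^ R * 2 ≤ (n : ℝ) ^ R * (n : ℝ) ^ (b * (1 - θ) - R) := by
          gcongr
          exact h_two
      _ = ((n : ℝ) ^ b) ^ (1 - θ) := by
          rw [← Real.rpow_add hn₀, ← Real.rpow_mul hn₀.le, add_sub_cancel]
      _ ≤ (⌈(n : ℝ) ^ b⌉₊ : ℝ) ^ (1 - θ) :=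
          Real.rpow_le_rpow (by positivity) (Nat.le_ceil _) (sub_nonneg.2 hθ₁.le)
  have h_words : ⌊(n : ℝ) ^ (n * R)⌋₊ ≤ W.card := Nat.floor_le_of_le <| calc
    (n : ℝ) ^ (n * R) = ((n : ℝ) ^ R) ^ n := by rw [← Real.rpow_mul_natCast hn₀.le, mul_comm R]
    _ ≤ ((⌈(n : ℝ) ^ b⌉₊ : ℝ) ^ (1 - θ) / 2) ^ n := by gcongr
    _ ≤ W.card := rpow_one_sub_div_two_pow_le hq hθ.le h_card
  refine ⟨fun i => W.equivFin.symm (Fin.castLE h_words i), fun i j hij => ?_⟩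
  have h_lt := hW (Subtype.prop _) (Subtype.prop _) fun h => hij
    (Fin.castLE_injective h_words (W.equivFin.symm.injective (Subtype.ext h)))
  exact ((Nat.lt_floor_add_one _).trans_le (by exact_mod_cast h_lt)).le

/-! ### Codewords on a grid -/

section Grid

variable {A : ℝ} {n q : ℕ}

/-- The word `x` over the alphabet `{0, …, q - 1}` as a point of the cube `[0, √A]ⁿ`, on a grid of
mesh `√A / q`: it turns codes with large Hamming distance into codewords with large Euclidean
distance. -/
def gridPoint (A : ℝ) (x : Fin n → Fin q) : Fin n → ℝ := fun t => √A * (x t / q)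

lemma gridPoint_mem_Icc (x : Fin n → Fin q) (t : Fin n) : gridPoint A x t ∈ Set.Icc 0 √A := by
  have h_le : ((x t : ℕ) : ℝ) / q ≤ 1 :=
    div_le_one_of_le₀ (by exact_mod_cast (x t).2.le) (by positivity)
  exact ⟨by unfold gridPoint; positivity, mul_le_of_le_one_right (Real.sqrt_nonneg A) h_le⟩

lemma one_le_natCast_sub_sq {a b : ℕ} (hab : a ≠ b) : (1 : ℝ) ≤ ((a : ℝ) - b) ^ 2 := by
  have h : (1 : ℤ) ≤ ((a : ℤ) - b) ^ 2 := (sq_pos_of_ne_zero (by omega : (a : ℤ) - b ≠ 0))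
  exact_mod_cast h

lemma mul_hammingDist_le_sqNorm_gridPoint_sub (hA : 0 ≤ A) (x y : Fin n → Fin q) :
    A / q ^ 2 * hammingDist x y ≤ sqNorm (gridPoint A x - gridPoint A y) := by
  have h_coord (t : Fin n) :
      (gridPoint A x - gridPoint A y) t ^ 2 = A / q ^ 2 * ((x t : ℝ) - y t) ^ 2 := by
    rw [Pi.sub_apply, gridPoint, gridPoint, ← mul_sub, ← sub_div, mul_pow, Real.sq_sqrt hA,
      div_pow]
    ring
  rw [hammingDist, mul_comm, ← nsmul_eq_mul, ← Finset.sum_const]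
  refine (Finset.sum_le_sum fun t ht => ?_).trans
    (Finset.sum_le_univ_sum_of_nonneg fun t => sq_nonneg _)
  rw [h_coord]
  exact le_mul_of_one_le_right (by positivity)
    (one_le_natCast_sub_sq (Fin.val_injective.ne (Finset.mem_filter.1 ht).2))

lemma exists_pairwise_mul_rpow_le_sqNorm_sub (hA : 0 < A) {b R : ℝ} (hb : 0 < b) (hRb : R < b) :
    ∃ κ > 0, ∀ᶠ n : ℕ in atTop, ∃ u : Fin ⌊(n : ℝ) ^ (n * R)⌋₊ → Fin n → ℝ,
      (∀ i t, u i t ∈ Set.Icc 0 √A) ∧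
        Pairwise fun i j => κ * (n : ℝ) ^ (1 - 2 * b) ≤ sqNorm (u i - u j) := by
  obtain ⟨θ, hθ, h_code⟩ := exists_pairwise_mul_le_hammingDist hb hRb
  refine ⟨A * θ / 4, by positivity, ?_⟩
  filter_upwards [h_code, eventually_ge_atTop 1] with n ⟨x, hx⟩ hn
  refine ⟨fun i => gridPoint A (x i), fun i => gridPoint_mem_Icc (x i), fun i j hij => ?_⟩
  have hn₀ : (0 : ℝ) < n := by exact_mod_cast hn
  have h_levels : (⌈(n : ℝ) ^ b⌉₊ : ℝ) ≤ 2 * (n : ℝ) ^ b := by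
    have : 1 ≤ (n : ℝ) ^ b := Real.one_le_rpow (by exact_mod_cast hn) hb.le
    linarith [Nat.ceil_lt_add_one (show 0 ≤ (n : ℝ) ^ b by positivity)]
  have : (0 : ℝ) < ⌈(n : ℝ) ^ b⌉₊ :=
    (Real.rpow_pos_of_pos hn₀ b).trans_le (Nat.le_ceil _)
  calc A * θ / 4 * (n : ℝ) ^ (1 - 2 * b) = A / (2 * (n : ℝ) ^ b) ^ 2 * (θ * n) := by
        rw [Real.rpow_sub hn₀, Real.rpow_one, mul_comm 2 b, Real.rpow_mul hn₀.le, Real.rpow_two]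
        field_simp
        norm_num
    _ ≤ A / (⌈(n : ℝ) ^ b⌉₊ : ℝ) ^ 2 * hammingDist (x i) (x j) := by
        gcongr
        exact hx hij
    _ ≤ sqNorm (gridPoint A (x i) - gridPoint A (x j)) :=
        mul_hammingDist_le_sqNorm_gridPoint_sub hA.le _ _

end Grid

/-! ### Achievability -/

section Fading

variable {Ph : Measure ℝ} [IsProbabilityMeasure Ph] {n : ℕ}

lemma exists_pos_measureReal_le_sq (hPh : Ph {0} < 1) :
    ∃ c : ℝ, 0 < c ∧ 0 < Ph.real {x | c ≤ x ^ 2} := by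
  by_contra! h_null
  have h_null_seq (k : ℕ) : Ph {x | 1 / ((k : ℝ) + 1) ≤ x ^ 2} = 0 :=
    (measureReal_eq_zero_iff (measure_ne_top _ _)).1
      (le_antisymm (h_null _ (by positivity)) measureReal_nonneg)
  have h_sub : ({0}ᶜ : Set ℝ) ⊆ ⋃ k : ℕ, {x | 1 / ((k : ℝ) + 1) ≤ x ^ 2} := fun x hx => by
    obtain ⟨k, hk⟩ := exists_nat_one_div_lt (sq_pos_of_ne_zero hx)
    exact Set.mem_iUnion.2 ⟨k, hk.le⟩
  exact hPh.ne ((prob_compl_eq_zero_iff (measurableSet_singleton 0)).1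
    (measure_mono_null h_sub (measure_iUnion_null h_null_seq)))

lemma variance_const_mul_indicator_le {G : Set ℝ} (hG : MeasurableSet G) (a : ℝ) :
    Var[fun x => a * G.indicator 1 x; Ph] ≤ a ^ 2 / 4 := by
  have h_mem (x : ℝ) : G.indicator 1 x ∈ Set.Icc (0 : ℝ) 1 := by
    by_cases hx : x ∈ G <;> simp [hx]
  have h_var := variance_le_sq_of_bounded (μ := Ph) (ae_of_all _ h_mem)
    (measurable_one.indicator hG).aemeasurable
  rw [variance_const_mul a]
  linarith [mul_le_mul_of_nonneg_left h_var (sq_nonneg a)]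

lemma fadingLaw_sum_indicator_lt_le {G : Set ℝ} (hG : MeasurableSet G) (hp : 0 < Ph.real G)
    {d : Fin n → ℝ} {B : ℝ} (hd : ∀ t, d t ^ 2 ≤ B) (hd_pos : 0 < sqNorm d) :
    fadingLaw Ph n {h | ∑ t, d t ^ 2 * G.indicator 1 (h t) < Ph.real G * sqNorm d / 2} ≤
      ENNReal.ofReal (B / (Ph.real G ^ 2 * sqNorm d)) := by
  set p := Ph.real G
  let X (t : Fin n) (x : ℝ) : ℝ := d t ^ 2 * G.indicator 1 x
  have h_memLp (t : Fin n) : MemLp (X t) 2 Ph :=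
    (memLp_indicator_const 2 hG 1 (Or.inr (measure_ne_top _ _))).const_mul _
  have h_mean : ∑ t, ∫ x, X t x ∂Ph = p * sqNorm d := by
    simp only [X, integral_const_mul, integral_indicator_one hG, ← Finset.sum_mul, sqNorm,
      mul_comm, p]
  have h_var : ∑ t, Var[X t; Ph] ≤ B * sqNorm d / 4 := by
    rw [sqNorm, Finset.mul_sum, Finset.sum_div]
    refine Finset.sum_le_sum fun t _ => (variance_const_mul_indicator_le hG _).trans ?_
    rw [sq]
    gcongr
    exact hd t
  have h_cheb := pi_abs_sum_sub_ge_le h_memLp (show 0 < p * sqNorm d / 2 by positivity)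
  rw [h_mean] at h_cheb
  refine (measure_mono fun h hh => ?_).trans (h_cheb.trans (ENNReal.ofReal_le_ofReal ?_))
  · have h_lt : ∑ t, X t (h t) < p * sqNorm d / 2 := hh
    have h_dev : p * sqNorm d / 2 ≤ |∑ t, X t (h t) - p * sqNorm d| :=
      le_abs.2 (Or.inr (by linarith))
    exact h_dev
  · calc (∑ t, Var[X t; Ph]) / (p * sqNorm d / 2) ^ 2
        ≤ B * sqNorm d / 4 / (p * sqNorm d / 2) ^ 2 := by gcongr
      _ = B / (p ^ 2 * sqNorm d) := by
        field_simp
        norm_num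

lemma fadingLaw_sqNorm_mul_lt_le {c : ℝ} (hc : 0 < c) (hp : 0 < Ph.real {x | c ≤ x ^ 2})
    {d : Fin n → ℝ} {B : ℝ} (hd : ∀ t, d t ^ 2 ≤ B) (hd_pos : 0 < sqNorm d) :
    fadingLaw Ph n {h | sqNorm (h * d) < c * Ph.real {x | c ≤ x ^ 2} * sqNorm d / 2} ≤
      ENNReal.ofReal (B / (Ph.real {x | c ≤ x ^ 2} ^ 2 * sqNorm d)) := by
  set G : Set ℝ := {x | c ≤ x ^ 2}
  have hG : MeasurableSet G := measurableSet_le measurable_const (by fun_prop)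
  refine (measure_mono fun h hh => ?_).trans (fadingLaw_sum_indicator_lt_le hG hp hd hd_pos)
  have h_indicator (x : ℝ) : c * G.indicator 1 x ≤ x ^ 2 := by
    by_cases hx : x ∈ G
    · rw [Set.indicator_of_mem hx, Pi.one_apply, mul_one]
      exact hx
    · simpa [hx] using sq_nonneg x
  have h_le : c * ∑ t, d t ^ 2 * G.indicator 1 (h t) ≤ sqNorm (h * d) := by
    rw [sqNorm, Finset.mul_sum]
    refine Finset.sum_le_sum fun t _ => ?_
    rw [Pi.mul_apply, mul_pow, mul_left_comm, mul_comm]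
    gcongr
    exact h_indicator (h t)
  have h_lt : sqNorm (h * d) < c * Ph.real G * sqNorm d / 2 := hh
  exact lt_of_mul_lt_mul_left (by linarith) hc.le

end Fading

section ThresholdCode

variable {Ph : Measure ℝ} {A σ : ℝ} {M n : ℕ}

lemma DICode.IsReliable.mono {C : DICode A M n} {l₁ l₂ k₁ k₂ : ℝ} (hC : C.IsReliable Ph σ l₁ l₂)
    (h₁ : l₁ ≤ k₁) (h₂ : l₂ ≤ k₂) : C.IsReliable Ph σ k₁ k₂ :=
  ⟨fun i => (hC.1 i).trans (ENNReal.ofReal_le_ofReal h₁),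
    fun i j hij => (hC.2 i j hij).trans (ENNReal.ofReal_le_ofReal h₂)⟩

lemma sub_sq_le_of_mem_Icc_sqrt (hA : 0 ≤ A) {x y : ℝ} (hx : x ∈ Set.Icc 0 √A)
    (hy : y ∈ Set.Icc 0 √A) : (x - y) ^ 2 ≤ A := by
  rw [← Real.sq_sqrt hA]
  exact sq_le_sq' (by linarith [hx.1, hy.2]) (by linarith [hx.2, hy.1])

lemma sqNorm_le_of_forall_mem_Icc (hA : 0 ≤ A) {u : Fin n → ℝ}
    (hu : ∀ t, u t ∈ Set.Icc 0 √A) : sqNorm u ≤ n * A := by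
  have h_coord (t : Fin n) : u t ^ 2 ≤ A := (Real.le_sqrt (hu t).1 hA).1 (hu t).2
  exact (Finset.sum_le_sum fun t _ => h_coord t).trans_eq (by simp)

lemma noiseLaw_sqNorm_add_le {w : Fin n → ℝ} {r : ℝ} (hr : 0 < r) (hw : 4 * r ≤ sqNorm w) :
    noiseLaw σ n {z | sqNorm (z + w) ≤ n * σ ^ 2 + r} ≤
      ENNReal.ofReal (n * Var[fun x => x ^ 2; noiseCoordLaw σ] / r ^ 2) +
        ENNReal.ofReal (4 * σ ^ 2 / r) := by
  have hw₀ : 0 < sqNorm w := by linarith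
  have h_sub : {z : Fin n → ℝ | sqNorm (z + w) ≤ n * σ ^ 2 + r} ⊆
      {z | r ≤ |sqNorm z - n * σ ^ 2|} ∪ {z | sqNorm w / 4 ≤ |∑ t, w t * z t|} := by
    intro z hz
    have hz : sqNorm (z + w) ≤ n * σ ^ 2 + r := hz
    rw [sqNorm_add] at hz
    refine or_iff_not_imp_left.2 fun h_norm => ?_
    have h_norm : ¬ r ≤ |sqNorm z - n * σ ^ 2| := h_norm
    have h_inner : sqNorm w / 4 ≤ |∑ t, w t * z t| :=
      le_abs.2 (Or.inr (by linarith [(abs_lt.1 (not_le.1 h_norm)).1]))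
    exact h_inner
  have h_inner : σ ^ 2 * sqNorm w / (sqNorm w / 4) ^ 2 ≤ 4 * σ ^ 2 / r := by
    rw [div_le_div_iff₀ (by positivity) hr]
    nlinarith [mul_nonneg (mul_nonneg (sq_nonneg σ) hw₀.le) (sub_nonneg.2 hw)]
  refine (measure_mono h_sub).trans ((measure_union_le _ _).trans (add_le_add
    (noiseLaw_abs_sqNorm_sub_ge_le σ n hr)
    ((noiseLaw_abs_inner_ge_le σ w (by positivity)).trans (ENNReal.ofReal_le_ofReal h_inner))))

/-- The code with codewords `u` whose decoder accepts message `i` if the output `𝐲` satisfies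
`‖𝐲 - diag(𝐡) 𝐮ᵢ‖₂² ≤ s`. -/
def thresholdCode (u : Fin M → Fin n → ℝ) (hu : ∀ i, sqNorm (u i) ≤ n * A) (s : ℝ) :
    DICode A M n where
  u := u
  D i h := {y | sqNorm (y - h * u i) ≤ s}
  power := hu
  measurable_D i := measurableSet_le
    (measurable_sqNorm.comp (measurable_snd.sub (measurable_fst.mul_const (u i)))) measurable_const

variable {u : Fin M → Fin n → ℝ} (hu : ∀ i, sqNorm (u i) ≤ n * A)

lemma acceptProb_thresholdCode (s : ℝ) (i j : Fin M) (h : Fin n → ℝ) :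
    (thresholdCode u hu s).acceptProb σ i j h =
      noiseLaw σ n {z | sqNorm (z + h * (u i - u j)) ≤ s} := by
  simp only [mul_sub, ← add_sub_assoc]
  rfl

variable [IsProbabilityMeasure Ph]

lemma err₁_thresholdCode_le (hσ : σ ≠ 0) {r : ℝ} (hr : 0 < r) (i : Fin M) :
    (thresholdCode u hu (n * σ ^ 2 + r)).err₁ Ph σ i ≤
      ENNReal.ofReal (n * Var[fun x => x ^ 2; noiseCoordLaw σ] / r ^ 2) := by
  rw [DICode.err₁_eq_lintegral hσ]
  refine (lintegral_mono fun h => ?_).trans_eq ((lintegral_const _).trans (by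
    rw [measure_univ, mul_one]))
  refine (measure_mono fun z hz => ?_).trans (noiseLaw_abs_sqNorm_sub_ge_le σ n hr)
  have hz : ¬ sqNorm (z + h * u i - h * u i) ≤ n * σ ^ 2 + r := hz
  rw [add_sub_cancel_right, not_le] at hz
  have h_dev : r ≤ |sqNorm z - n * σ ^ 2| := le_abs.2 (Or.inl (by linarith))
  exact h_dev

lemma err₂_thresholdCode_le (hσ : σ ≠ 0) {r : ℝ} (hr : 0 < r) (i j : Fin M) :
    (thresholdCode u hu (n * σ ^ 2 + r)).err₂ Ph σ i j ≤
      ENNReal.ofReal (n * Var[fun x => x ^ 2; noiseCoordLaw σ] / r ^ 2) +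
        ENNReal.ofReal (4 * σ ^ 2 / r) +
        fadingLaw Ph n {h | sqNorm (h * (u i - u j)) < 4 * r} := by
  set e := ENNReal.ofReal (n * Var[fun x => x ^ 2; noiseCoordLaw σ] / r ^ 2) +
    ENNReal.ofReal (4 * σ ^ 2 / r)
  set B := {h : Fin n → ℝ | sqNorm (h * (u i - u j)) < 4 * r}
  have hB : MeasurableSet B := measurableSet_lt (by fun_prop) measurable_const
  have h_accept (h : Fin n → ℝ) :
      (thresholdCode u hu (n * σ ^ 2 + r)).acceptProb σ i j h ≤ e + B.indicator 1 h := by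
    by_cases hh : h ∈ B
    · rw [Set.indicator_of_mem hh]
      exact prob_le_one.trans le_add_self
    · rw [Set.indicator_of_notMem hh, add_zero, acceptProb_thresholdCode]
      exact noiseLaw_sqNorm_add_le hr (not_lt.1 hh)
  rw [DICode.err₂_eq_lintegral_acceptProb hσ]
  refine (lintegral_mono h_accept).trans_eq ?_
  rw [lintegral_add_left measurable_const, lintegral_const, measure_univ, mul_one,
    lintegral_indicator_one hB]

end ThresholdCode

lemma exists_isReliable_of_pairwise_le_sqNorm_sub {Ph : Measure ℝ} [IsProbabilityMeasure Ph]
    {A σ : ℝ} (hPh : Ph {0} < 1) (hA : 0 ≤ A) (hσ : σ ≠ 0) :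
    ∃ v w : ℝ, ∀ {M n : ℕ} {u : Fin M → Fin n → ℝ} {ρ : ℝ}, 0 < ρ →
      (∀ i t, u i t ∈ Set.Icc 0 √A) → (Pairwise fun i j => ρ ≤ sqNorm (u i - u j)) →
      ∃ C : DICode A M n,
        C.IsReliable Ph σ (v * (n / ρ ^ 2) + w / ρ) (v * (n / ρ ^ 2) + w / ρ) := by
  obtain ⟨c, hc, hp⟩ := exists_pos_measureReal_le_sq hPh
  set p := Ph.real {x | c ≤ x ^ 2}
  set V := Var[fun x => x ^ 2; noiseCoordLaw σ]
  have hV : 0 ≤ V := variance_nonneg _ _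
  refine ⟨64 * V / (c * p) ^ 2, 32 * σ ^ 2 / (c * p) + A / p ^ 2,
    fun {M n u ρ} hρ hu h_sep => ?_⟩
  have h_power (i : Fin M) : sqNorm (u i) ≤ n * A := sqNorm_le_of_forall_mem_Icc hA (hu i)
  set r := c * p * ρ / 8
  have hr : 0 < r := by positivity
  have h_eq : 64 * V / (c * p) ^ 2 * (n / ρ ^ 2) + (32 * σ ^ 2 / (c * p) + A / p ^ 2) / ρ =
      n * V / r ^ 2 + 4 * σ ^ 2 / r + A / (p ^ 2 * ρ) := by
    simp only [r]
    field_simp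
    ring
  rw [h_eq]
  refine ⟨thresholdCode u h_power (n * σ ^ 2 + r), fun i => ?_, fun i j hij => ?_⟩
  · refine (err₁_thresholdCode_le h_power hσ hr i).trans (ENNReal.ofReal_le_ofReal ?_)
    rw [add_assoc]
    exact le_add_of_nonneg_right (by positivity)
  · set d := u i - u j
    have hd : ρ ≤ sqNorm d := h_sep hij
    have h_coord (t : Fin n) : d t ^ 2 ≤ A := sub_sq_le_of_mem_Icc_sqrt hA (hu i t) (hu j t)
    have h_fade : fadingLaw Ph n {h | sqNorm (h * d) < 4 * r} ≤
        ENNReal.ofReal (A / (p ^ 2 * ρ)) := by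
      have h_r : 4 * r ≤ c * p * sqNorm d / 2 := by
        linarith [mul_le_mul_of_nonneg_left hd (mul_pos hc hp).le,
          show r = c * p * ρ / 8 from rfl]
      refine (measure_mono fun h hh => ?_).trans ((fadingLaw_sqNorm_mul_lt_le hc hp h_coord
        (hρ.trans_le hd)).trans (ENNReal.ofReal_le_ofReal (by gcongr)))
      have hh : sqNorm (h * d) < 4 * r := hh
      exact hh.trans_le h_r
    rw [ENNReal.ofReal_add (by positivity) (by positivity),
      ENNReal.ofReal_add (by positivity) (by positivity)]
    exact (err₂_thresholdCode_le h_power hσ hr i j).trans (by gcongr)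

lemma tendsto_mul_div_add_div_rpow {a κ : ℝ} (ha : 1 / 2 < a) (v w : ℝ) :
    Tendsto (fun n : ℕ => v * (n / (κ * (n : ℝ) ^ a) ^ 2) + w / (κ * (n : ℝ) ^ a)) atTop
      (nhds 0) := by
  have h_decay {c : ℝ} (hc : 0 < c) : Tendsto (fun n : ℕ => (n : ℝ) ^ (-c)) atTop (nhds 0) :=
    (tendsto_rpow_neg_atTop hc).comp tendsto_natCast_atTop_atTop
  have h_lim := ((h_decay (show 0 < 2 * a - 1 by linarith)).const_mul (v / κ ^ 2)).add
    ((h_decay (show 0 < a by linarith)).const_mul (w / κ))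
  rw [mul_zero, mul_zero, add_zero] at h_lim
  refine h_lim.congr' ?_
  filter_upwards [eventually_gt_atTop 0] with n hn
  have hn₀ : (0 : ℝ) < n := by exact_mod_cast hn
  rw [neg_sub, Real.rpow_sub hn₀, Real.rpow_one, mul_comm 2 a, Real.rpow_mul hn₀.le,
    Real.rpow_two, Real.rpow_neg hn₀.le]
  ring

theorem Achievable.of_lt_quarter {Ph : Measure ℝ} [IsProbabilityMeasure Ph] {A σ R : ℝ}
    (hPh : Ph {0} < 1) (hA : 0 < A) (hσ : σ ≠ 0) (hR₀ : 0 < R) (hR : R < 1 / 4) :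
    Achievable Ph A σ R := by
  refine ⟨hR₀, fun l₁ l₂ hl₁ hl₂ => ?_⟩
  obtain ⟨b, hRb, hb⟩ := exists_between hR
  obtain ⟨κ, hκ, h_words⟩ := exists_pairwise_mul_rpow_le_sqNorm_sub hA (hR₀.trans hRb) hRb
  obtain ⟨v, w, h_code⟩ := exists_isReliable_of_pairwise_le_sqNorm_sub hPh hA.le hσ
  have h_error := tendsto_mul_div_add_div_rpow (κ := κ) (show 1 / 2 < 1 - 2 * b by linarith) v w
  filter_upwards [h_words, h_error.eventually_le_const (lt_min hl₁ hl₂), eventually_gt_atTop 0]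
    with n ⟨u, hu, h_sep⟩ h_le hn
  have hn₀ : (0 : ℝ) < n := by exact_mod_cast hn
  obtain ⟨C, hC⟩ := h_code (mul_pos hκ (Real.rpow_pos_of_pos hn₀ _)) hu h_sep
  exact ⟨C, hC.mono (h_le.trans (min_le_left _ _)) (h_le.trans (min_le_right _ _))⟩

theorem quarter_le_capacity {Ph : Measure ℝ} [IsProbabilityMeasure Ph] {A σ : ℝ}
    (hPh : Ph {0} < 1) (hA : 0 < A) (hσ : σ ≠ 0) : 1 / 4 ≤ capacity Ph A σ := by
  have h_quarter : (1 / 4 : ℝ≥0∞) = ENNReal.ofReal (1 / 4) := by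
    rw [ENNReal.ofReal_div_of_pos four_pos, ENNReal.ofReal_one, ENNReal.ofReal_ofNat]
  rw [h_quarter]
  refine le_of_forall_lt fun a ha => ?_
  obtain ⟨R, haR, hR⟩ := exists_between ((ENNReal.lt_ofReal_iff_toReal_lt ha.ne_top).1 ha)
  have hR₀ : 0 < R := ENNReal.toReal_nonneg.trans_lt haR
  exact ((ENNReal.lt_ofReal_iff_toReal_lt ha.ne_top).2 haR).trans_le
    (le_iSup₂_of_le R (.of_lt_quarter hPh hA hσ hR₀ hR) le_rfl)

end

end FastFading

theorem mainTheorem3_general (Ph : Measure ℝ) [IsProbabilityMeasure Ph] (A σ : ℝ) (hA : 0 < A)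
    (hσ : 0 < σ) :
    (Integrable (fun x : ℝ => x ^ 2) Ph → FastFading.capacity Ph A σ ≤ 1 / 2) ∧
    (Ph {0} < 1 → 1 / 4 ≤ FastFading.capacity Ph A σ) :=
  ⟨fun h_second => FastFading.capacity_le_half h_second hσ.ne',
    fun h_zero => FastFading.quarter_le_capacity h_zero hA hσ.ne'⟩

theorem mainTheorem3 (Ph : Measure ℝ) [IsProbabilityMeasure Ph] (A σ : ℝ) (hA : 0 < A)
    (hσ : 0 < σ) :
    (Integrable (fun x : ℝ => x ^ 2) Ph → FastFading.capacity Ph A σ ≤ 1 / 2) ∧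
    (Ph {0} = 0 → 1 / 4 ≤ FastFading.capacity Ph A σ) ∧
    (Ph {0} < 1 → Integrable (fun x : ℝ => x ^ 4) Ph → 1 / 4 ≤ FastFading.capacity Ph A σ) :=
  have h_general := mainTheorem3_general Ph A σ hA hσ
  ⟨h_general.1, fun h_zero => h_general.2 (h_zero ▸ one_pos), fun h_zero _ => h_general.2 h_zero⟩
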